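/- Let $A\in\mathbb R^{n\times n}$, $B\in\mathbb R^{n\times m}$, $C\in\mathbb R^{m\times n}$, $D\in\mathbb R^{m\times m}$, and write $\mathbb R[x,w,\lambda]$ for the polynomials in $x=(x_1,\dots,x_n)$, $w=(w_1,\dots,w_m)$ and $\lambda$. Let $E$ consist of the polynomials $$(Ax+Bw-\lambda x)_i\ (1\le i\le n),\qquad w_j(Cx+Dw)_j-w_j^2\ (1\le j\le m),\qquad \sum_{i}x_i^2+\sum_j w_j^2-1,$$ let $I$ be the ideal of $\mathbb R[x,w,\lambda]$ generated by $E$, and let $$G=\{\,w_iw_j,\ \ w_jw_i-w_j(Cx+Dw)_i,\ \ [w_i-(Cx+Dw)_i][w_j-(Cx+Dw)_j]\ :\ 1\le i,j\le m\,\}.$$ For $f\in\mathbb R[x,w,\lambda]$ let $f^{\min}$ be the minimum of $f$ over the real points $(x,w,\lambda)$ with $e=0$ for all $e\in E$, $\lambda\ge0$ and $g\ge0$ for all $g\in G$ (the infimum, with $f^{\min}=+\infty$ if there is no such point). For $N\ge1$ and a real vector $y=(y_\alpha)$ indexed by the multi-indices $\alpha\in\mathbb N^{n+m+1}$ with $|\alpha|\le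 2N$, put $L_y(p)=\sum_\alpha p_\alpha y_\alpha$; let $H_k(y)$ be the matrix $(y_{\beta+\gamma})_{|\beta|,|\gamma|\le k}$, and $H_{k}(py)$ the matrix $\big(\sum_\alpha p_\alpha y_{\alpha+\beta+\gamma}\big)_{|\beta|,|\gamma|\le k}$. Consider the moment relaxation $$f_N^{\mathrm{mom}}=\inf_y\{L_y(f)\ :\ y_0=1,\ H_N(y)\succeq0,\ H_{N-1}(ey)=0\ \forall e\in E,\ H_{N-1}(\lambda y)\succeq0,\ H_{N-1}(gy)\succeq0\ \forall g\in G\}$$ and its dual, the sum-of-squares relaxation: $f_N^{\mathrm{sos}}$ is the supremum of the $\rho\in\mathbb R$ such that $$f-\rho=\sigma_0+\lambda\sigma_\lambda+\sum_{g\in G}g\,\sigma_g+\sum_{e\in E}p_e e,$$ where $\sigma_0$ is a finite sum of squares of polynomials of degree at most $N$, $\sigma_\lambda$ and all $\sigma_g$ are finite sums of squares of polynomials of degree at most $N-1$, and $\deg p_e\le 2N-2$ for all $e\in E$. (As usual $\inf\emptyset=+\infty$ and $\sup\emptyset=-\infty$.) Assume that $I$ is zero-dimensional, i.e. that its complex variety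 $V_{\mathbb C}(I)\subset\mathbb C^{n+m+1}$ is finite. Then: 1. $f_N^{\mathrm{mom}}=f_N^{\mathrm{sos}}=f^{\min}$ for all sufficiently large $N$. 2. For all sufficiently large $N$ there is an integer $s$ with $1\le s\le N$ such that, for every optimal solution $y$ of the moment relaxation of order $N$ for which $\operatorname{rank}H_N(y)$ is maximal among its optimal solutions, $\operatorname{rank}H_s(y)=\operatorname{rank}H_{s-1}(y)$ and the set of minimizers of $f$ over the feasible set above is equal to $V_{\mathbb C}(\ker H_s(y))$, the set of common zeros in $\mathbb C^{n+m+1}$ of all real polynomials $\sum_{|\alpha|\le s}c_\alpha (x,w,\lambda)^\alpha$ with $H_s(y)c=0$. -/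

import Mathlib

open MvPolynomial

noncomputable section

namespace ReluPOP

/-- The variables `(x, w, lambda)`, that is `n + m + 1` of them. -/
abbrev Var (n m : ℕ) : Type := Fin n ⊕ Fin m ⊕ Unit

section System

variable {n m : ℕ}

/-- The coordinate polynomial `x_i`. -/
def xVar (i : Fin n) : MvPolynomial (Var n m) ℝ := X (Sum.inl i)

/-- The coordinate polynomial `w_j`. -/
def wVar (j : Fin m) : MvPolynomial (Var n m) ℝ := X (Sum.inr (Sum.inl j))

/-- The coordinate polynomial `lambda`. -/
def lamVar : MvPolynomial (Var n m) ℝ := X (Sum.inr (Sum.inr ()))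

/-- The polynomial `(C x + D w)_j`. -/
def zPoly (C : Matrix (Fin m) (Fin n) ℝ) (D : Matrix (Fin m) (Fin m) ℝ) (j : Fin m) :
    MvPolynomial (Var n m) ℝ :=
  ∑ k, MvPolynomial.C (C j k) * xVar k + ∑ k, MvPolynomial.C (D j k) * wVar k

/-- Index set of the equality constraints: `n` eigenvalue equations, `m` complementarity
equations, one normalization. -/
abbrev EqIdx (n m : ℕ) : Type := Fin n ⊕ Fin m ⊕ Unit

/-- The equality constraints `e`: `(A x + B w - lambda x)_i`, `w_j (C x + D w)_j - w_j ^ 2`, and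
`∑ x_i ^ 2 + ∑ w_j ^ 2 - 1`. -/
def ePoly (A : Matrix (Fin n) (Fin n) ℝ) (B : Matrix (Fin n) (Fin m) ℝ)
    (C : Matrix (Fin m) (Fin n) ℝ) (D : Matrix (Fin m) (Fin m) ℝ) :
    EqIdx n m → MvPolynomial (Var n m) ℝ
  | Sum.inl i =>
      ∑ k, MvPolynomial.C (A i k) * xVar k + ∑ k, MvPolynomial.C (B i k) * wVar k
        - lamVar * xVar i
  | Sum.inr (Sum.inl j) => wVar j * zPoly C D j - wVar j ^ 2
  | Sum.inr (Sum.inr _) => ∑ i, xVar i ^ 2 + ∑ j, wVar j ^ 2 - 1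

/-- Index set of the quadratic inequality constraints: three families indexed by pairs. -/
abbrev IneqIdx (m : ℕ) : Type :=
  (Fin m × Fin m) ⊕ (Fin m × Fin m) ⊕ (Fin m × Fin m)

/-- The inequality constraints `g`: `w_i w_j`, `w_j w_i - w_j (C x + D w)_i`, and
`(w_i - (C x + D w)_i) (w_j - (C x + D w)_j)`. -/
def gPoly (C : Matrix (Fin m) (Fin n) ℝ) (D : Matrix (Fin m) (Fin m) ℝ) :
    IneqIdx m → MvPolynomial (Var n m) ℝ
  | Sum.inl (i, j) => wVar i * wVar j
  | Sum.inr (Sum.inl (i, j)) => wVar j * wVar i - wVar j * zPoly C D i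
  | Sum.inr (Sum.inr (i, j)) => (wVar i - zPoly C D i) * (wVar j - zPoly C D j)

variable (A : Matrix (Fin n) (Fin n) ℝ) (B : Matrix (Fin n) (Fin m) ℝ)
  (C : Matrix (Fin m) (Fin n) ℝ) (D : Matrix (Fin m) (Fin m) ℝ)

/-- The ideal `I` generated by the equality constraints. -/
def eqIdeal : Ideal (MvPolynomial (Var n m) ℝ) := Ideal.span (Set.range (ePoly A B C D))

/-- The real feasible set of the polynomial optimization problem. -/
def feasibleSet : Set (Var n m → ℝ) :=
  {v | (∀ e, eval v (ePoly A B C D e) = 0) ∧ 0 ≤ eval v (lamVar (n := n) (m := m)) ∧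
    ∀ g, 0 ≤ eval v (gPoly C D g)}

/-- The optimal value `f^min`, equal to `+∞` when the problem is infeasible. -/
def fMin (f : MvPolynomial (Var n m) ℝ) : EReal :=
  ⨅ v ∈ feasibleSet A B C D, ((eval v f : ℝ) : EReal)

/-- The set of minimizers of the polynomial optimization problem. -/
def minimizers (f : MvPolynomial (Var n m) ℝ) : Set (Var n m → ℝ) :=
  {v ∈ feasibleSet A B C D | ∀ v' ∈ feasibleSet A B C D, eval v f ≤ eval v' f}

end System

/-- An ideal is zero-dimensional when its complex variety is finite. -/
def IsZeroDimensional {σ : Type*} (I : Ideal (MvPolynomial σ ℝ)) : Prop :=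
  (zeroLocus ℂ I).Finite

section Moments

variable {σ : Type*}

/-- Multi-indices of degree at most `k`. -/
abbrev MIdx (σ : Type*) (k : ℕ) : Type _ := {α : σ →₀ ℕ // α.degree ≤ k}

instance instFintypeMIdx [Finite σ] (k : ℕ) : Fintype (MIdx σ k) :=
  (Finsupp.finite_of_degree_le (σ := σ) k).fintype

/-- Truncated pseudo-moment vectors, indexed by the multi-indices of degree at most `2 N`. -/
abbrev MomentVec (σ : Type*) (N : ℕ) : Type _ := MIdx σ (2 * N) → ℝ

/-- The entry `y_α`. Entries of degree above `2 N` are never read by the constraints below; they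
get the value `0`. -/
def MomentVec.entry {N : ℕ} (y : MomentVec σ N) (α : σ →₀ ℕ) : ℝ :=
  if h : α.degree ≤ 2 * N then y ⟨α, h⟩ else 0

/-- The linear functional `L_y (p) = ∑ α, p_α y_α`. -/
def riesz {N : ℕ} (y : MomentVec σ N) (p : MvPolynomial σ ℝ) : ℝ :=
  ∑ α ∈ p.support, coeff α p * y.entry α

/-- The Hankel (pseudo-moment) matrix `H_k (y)`, with entries `y_{β + γ}`. -/
def hankel {N : ℕ} (k : ℕ) (y : MomentVec σ N) : Matrix (MIdx σ k) (MIdx σ k) ℝ :=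
  Matrix.of fun β γ => y.entry (β.1 + γ.1)

/-- The localizing matrix `H_k (p y)`, with entries `∑ α, p_α y_{α + β + γ}`. -/
def localizing {N : ℕ} (k : ℕ) (p : MvPolynomial σ ℝ) (y : MomentVec σ N) :
    Matrix (MIdx σ k) (MIdx σ k) ℝ :=
  Matrix.of fun β γ => ∑ α ∈ p.support, coeff α p * y.entry (α + β.1 + γ.1)

/-- The polynomial of degree at most `k` with coefficient vector `c`. -/
def polyOfVec [Finite σ] {k : ℕ} (c : MIdx σ k → ℝ) : MvPolynomial σ ℝ :=
  ∑ α, monomial α.1 (c α)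

/-- `V_ℂ (ker H_k (y))`: the common complex zeros of the polynomials of degree at most `k` whose
coefficient vector lies in the kernel of `H_k (y)`. -/
def kernelVariety [Finite σ] {N : ℕ} (k : ℕ) (y : MomentVec σ N) : Set (σ → ℂ) :=
  {v | ∀ c : MIdx σ k → ℝ, (hankel k y).mulVec c = 0 → aeval v (polyOfVec c) = 0}

/-- Finite sums of squares of polynomials of degree at most `k`. -/
def IsSOS (k : ℕ) (p : MvPolynomial σ ℝ) : Prop :=
  ∃ (r : ℕ) (u : Fin r → MvPolynomial σ ℝ), (∀ l, (u l).totalDegree ≤ k) ∧ p = ∑ l, u l ^ 2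

end Moments

section Hierarchy

variable {n m : ℕ} (A : Matrix (Fin n) (Fin n) ℝ) (B : Matrix (Fin n) (Fin m) ℝ)
  (C : Matrix (Fin m) (Fin n) ℝ) (D : Matrix (Fin m) (Fin m) ℝ)

/-- Feasibility for the moment relaxation of order `N`, including the normalization `y_0 = 1`. -/
structure MomFeasible (N : ℕ) (y : MomentVec (Var n m) N) : Prop where
  normalized : y.entry 0 = 1
  hankel_psd : (hankel N y).PosSemidef
  eq_zero : ∀ e, localizing (N - 1) (ePoly A B C D e) y = 0
  lam_psd : (localizing (N - 1) lamVar y).PosSemidef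
  ineq_psd : ∀ g, (localizing (N - 1) (gPoly C D g) y).PosSemidef

/-- The value `f_N^mom` of the moment relaxation. -/
def fMom (f : MvPolynomial (Var n m) ℝ) (N : ℕ) : EReal :=
  ⨅ (y : MomentVec (Var n m) N) (_ : MomFeasible A B C D N y), ((riesz y f : ℝ) : EReal)

/-- Optimal solutions of the moment relaxation of order `N`. -/
def IsMomOptimal (f : MvPolynomial (Var n m) ℝ) (N : ℕ) (y : MomentVec (Var n m) N) : Prop :=
  MomFeasible A B C D N y ∧ ∀ y', MomFeasible A B C D N y' → riesz y f ≤ riesz y' f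

/-- Optimal solutions `y` for which the rank of `H_N (y)` is maximal among all optimal
solutions. -/
def IsMaxRankOptimal (f : MvPolynomial (Var n m) ℝ) (N : ℕ) (y : MomentVec (Var n m) N) :
    Prop :=
  IsMomOptimal A B C D f N y ∧
    ∀ y', IsMomOptimal A B C D f N y' → (hankel N y').rank ≤ (hankel N y).rank

/-- Feasibility of `ρ` for the sum of squares relaxation of order `N`. -/
def SosFeasible (f : MvPolynomial (Var n m) ℝ) (N : ℕ) (ρ : ℝ) : Prop :=
  ∃ (s₀ sl : MvPolynomial (Var n m) ℝ) (sg : IneqIdx m → MvPolynomial (Var n m) ℝ)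
    (p : EqIdx n m → MvPolynomial (Var n m) ℝ),
    IsSOS N s₀ ∧ IsSOS (N - 1) sl ∧ (∀ g, IsSOS (N - 1) (sg g)) ∧
    (∀ e, (p e).totalDegree ≤ 2 * N - 2) ∧
    f - MvPolynomial.C ρ = s₀ + lamVar * sl + ∑ g, gPoly C D g * sg g + ∑ e, p e * ePoly A B C D e

/-- The value `f_N^sos` of the sum of squares relaxation. -/
def fSos (f : MvPolynomial (Var n m) ℝ) (N : ℕ) : EReal :=
  ⨆ (ρ : ℝ) (_ : SosFeasible A B C D f N ρ), (ρ : EReal)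

end Hierarchy

end ReluPOP

end

/-!
The real feasible set `K` is a subset of the finite complex variety `V` of the ideal `I`, and both
parts rest on one certificate (`exists_certificate`): a polynomial `p` of degree at most `d` that is
nonnegative on `K` becomes, after adding any `ε > 0`, an element of the truncated quadratic module,
with degrees bounded in terms of `d` only.

To see this, interpolate square roots on `V` by real polynomials.  At a real point of `V` either
`p ≥ 0` is a square, or some constraint `g` is negative and `p / g` is a square; at a pair of
conjugate nonreal points `-1` is a square, hence `p` is a sum of two squares
(`exists_quadraticModule_interpolation`).  So `p` agrees on `V` with an element `τ` of the quadratic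
module, and by the Nullstellensatz `q = p - τ` is nilpotent modulo `I`.  The truncated Taylor
series of the square root of `ε + t` then shows that `ε + q` is a square modulo `I`.  The
coefficients with respect to the generators of `I` have bounded degree because the elements of `I`
of bounded degree form a finite dimensional space (`exists_totalDegree_bound_span`).

Applied to `f - ρ`, the certificate gives `fMin ≤ fSos`, and weak duality closes the chain
`fMin ≤ fSos ≤ fMom ≤ fMin`.

Applied to `± p` with `p` vanishing on `K`, it shows that every feasible `y` of large order `N`
coincides, up to a given degree, with the moments of a probability measure on `K`
(`exists_forall_rieszHom_eq_sum`).  If `y` is optimal, the measure lives on the minimizers; if in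
addition `H_N (y)` has maximal rank, its kernel lies in that of every Dirac measure at a minimizer,
so that all minimizers have positive mass.  Hence, for `k` up to `s = |K| + 1`, the kernel of
`H_k (y)` consists of the polynomials of degree at most `k` that vanish at the minimizers
(`IsMaxRankOptimal.hankel_mulVec_eq_zero_iff`), and since polynomials of degree `|K| = s - 1` already
interpolate on `K`, the rank and the kernel variety can be read off.
-/

noncomputable section

namespace ReluPOP

/-! ### Interpolation by real polynomials at finitely many complex points -/

section Interpolation

variable {σ : Type*}

open ComplexConjugate

/-- A product of one affine linear form per point of `V`, each chosen to vanish at that point and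
not at `v`. -/
theorem exists_totalDegree_le_card_vanishing {F K : Type*} [Field F] [Field K] [Algebra F K]
    (V : Finset (σ → F)) (v : σ → K) (hv : ∀ u ∈ V, (fun i => algebraMap F K (u i)) ≠ v) :
    ∃ p : MvPolynomial σ F, p.totalDegree ≤ V.card ∧ (∀ u ∈ V, eval u p = 0) ∧
      aeval v p ≠ 0 := by
  classical
  induction V using Finset.induction_on with
  | empty => exact ⟨1, by simp, by simp, by simp⟩
  | insert u V hu ih =>
    obtain ⟨p, hdeg, hp, hpv⟩ := ih fun w hw => hv w (Finset.mem_insert_of_mem hw)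
    obtain ⟨i, hi⟩ := Function.ne_iff.1 (hv u (Finset.mem_insert_self u V))
    refine ⟨p * (X i - C (u i)), ?_, ?_, ?_⟩
    · rw [Finset.card_insert_of_notMem hu]
      refine (totalDegree_mul _ _).trans (add_le_add hdeg ?_)
      exact (totalDegree_sub_C_le _ _).trans (totalDegree_X i).le
    · intro w hw
      rcases Finset.mem_insert.1 hw with rfl | hw
      · simp
      · simp [hp w hw]
    · rw [map_mul]
      refine mul_ne_zero hpv ?_
      simpa [algebraMap_eq, sub_eq_zero] using fun h => hi h.symm

/-- Lagrange interpolation polynomial of a point `v` with respect to a finite set `V`. -/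
theorem exists_lagrange {F : Type*} [Field F] (V : Finset (σ → F)) (v : σ → F) :
    ∃ p : MvPolynomial σ F, p.totalDegree ≤ V.card ∧ eval v p = 1 ∧
      ∀ u ∈ V, u ≠ v → eval u p = 0 := by
  classical
  obtain ⟨p, hdeg, hp, hpv⟩ := exists_totalDegree_le_card_vanishing (K := F) (V.erase v) v
    fun u hu => Finset.ne_of_mem_erase hu
  rw [aeval_eq_eval] at hpv
  refine ⟨C (eval v p)⁻¹ * p, ?_, ?_, ?_⟩
  · refine (totalDegree_mul _ _).trans ?_
    rw [totalDegree_C, zero_add]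
    exact hdeg.trans (Finset.card_erase_le)
  · simp only [map_mul, eval_C]
    exact inv_mul_cancel₀ hpv
  · intro u hu huv
    simp [hp u (Finset.mem_erase.2 ⟨huv, hu⟩)]

theorem aeval_conj (v : σ → ℂ) (p : MvPolynomial σ ℝ) :
    aeval (fun i => conj (v i)) p = conj (aeval v p) := by
  induction p using MvPolynomial.induction_on with
  | C a => simp [algHom_C]
  | add p q hp hq => simp [hp, hq]
  | mul_X p i hp => simp [hp]

theorem aeval_ofReal (u : σ → ℝ) (p : MvPolynomial σ ℝ) :
    aeval (fun i => (u i : ℂ)) p = (eval u p : ℂ) := by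
  induction p using MvPolynomial.induction_on with
  | C a => simp [algHom_C]
  | add p q hp hq => simp [hp, hq]
  | mul_X p i hp => simp [hp]

/-- The real polynomial whose coefficients are the real parts of those of `p`. -/
def rePart (p : MvPolynomial σ ℂ) : MvPolynomial σ ℝ :=
  ∑ α ∈ p.support, monomial α (coeff α p).re

theorem totalDegree_rePart_le (p : MvPolynomial σ ℂ) :
    (rePart p).totalDegree ≤ p.totalDegree := by
  refine totalDegree_finsetSum_le fun α hα => (totalDegree_monomial_le _ _).trans ?_
  exact le_totalDegree hα

theorem two_mul_aeval_rePart (v : σ → ℂ) (p : MvPolynomial σ ℂ) :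
    2 * aeval v (rePart p) = eval v p + conj (eval (fun i => conj (v i)) p) := by
  rw [eval_eq, eval_eq, rePart, map_sum, map_sum, Finset.mul_sum, ← Finset.sum_add_distrib]
  refine Finset.sum_congr rfl fun α _ => ?_
  rw [aeval_monomial, map_mul, map_prod]
  simp only [map_pow, Complex.conj_conj, Finsupp.prod]
  rw [← add_mul, Complex.add_conj, ← mul_assoc]
  simp

/-- A conjugation equivariant function on a conjugation invariant finite set of complex points is
interpolated by a real polynomial: take the real part of the complex interpolant. -/
theorem exists_real_interpolation (V : Finset (σ → ℂ))
    (hV : ∀ v ∈ V, (fun i => conj (v i)) ∈ V) (F : (σ → ℂ) → ℂ)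
    (hF : ∀ v, F (fun i => conj (v i)) = conj (F v)) :
    ∃ p : MvPolynomial σ ℝ, p.totalDegree ≤ V.card ∧ ∀ v ∈ V, aeval v p = F v := by
  choose L hdeg hone hzero using exists_lagrange V
  have heval : ∀ v ∈ V, eval v (∑ u ∈ V, C (F u) * L u) = F v := by
    intro v hv
    rw [map_sum, Finset.sum_eq_single v]
    · simp [hone]
    · intro u _ huv
      simp [hzero u v hv huv.symm]
    · exact fun h => absurd hv h
  refine ⟨rePart (∑ u ∈ V, C (F u) * L u), ?_, fun v hv => ?_⟩
  · refine (totalDegree_rePart_le _).trans (totalDegree_finsetSum_le fun u _ => ?_)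
    refine (totalDegree_mul _ _).trans ?_
    rw [totalDegree_C, zero_add]
    exact hdeg u
  · have h := two_mul_aeval_rePart v (∑ u ∈ V, C (F u) * L u)
    rw [heval v hv, heval _ (hV v hv), hF, Complex.conj_conj, ← two_mul] at h
    exact mul_left_cancel₀ two_ne_zero h

/-- There is a square root of `-1` on the nonreal points that is compatible with conjugation: its
sign is that of the imaginary part of a coordinate chosen from the set of nonreal coordinates. -/
theorem exists_equivariant_I : ∃ J : (σ → ℂ) → ℂ,
    (∀ v, J (fun i => conj (v i)) = conj (J v)) ∧
    (∀ v, (∃ i, (v i).im ≠ 0) → J v ^ 2 = -1) ∧ ∀ v, (∀ i, (v i).im = 0) → J v = 0 := by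
  classical
  let c : ∀ S : Set σ, S.Nonempty → σ := fun S hS => hS.choose
  let S : (σ → ℂ) → Set σ := fun v => {i | (v i).im ≠ 0}
  let J : (σ → ℂ) → ℂ := fun v =>
    if h : (S v).Nonempty then Complex.I * ((v (c _ h)).im / |(v (c _ h)).im| : ℝ) else 0
  have hS : ∀ v, S (fun i => conj (v i)) = S v := fun v => by ext i; simp [S]
  have hc : ∀ (T U : Set σ) (hT : T.Nonempty) (hU : U.Nonempty), T = U → c T hT = c U hU := by
    rintro T U hT hU rfl
    rfl
  refine ⟨J, fun v => ?_, fun v hv => ?_, fun v hv => ?_⟩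
  · by_cases h : (S v).Nonempty
    · have h' : (S (fun i => conj (v i))).Nonempty := by rwa [hS]
      simp only [J, dif_pos h, dif_pos h', hc _ _ h' h (hS v)]
      simp [neg_div]
    · have h' : ¬ (S (fun i => conj (v i))).Nonempty := by rwa [hS]
      simp only [J, dif_neg h, dif_neg h', map_zero]
  · have h : (S v).Nonempty := hv
    have hne : (v (c _ h)).im ≠ 0 := h.choose_spec
    simp only [J, dif_pos h]
    rw [mul_pow, Complex.I_sq, ← Complex.ofReal_pow, div_pow, sq_abs,
      div_self (pow_ne_zero 2 hne)]
    simp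
  · have h : ¬ (S v).Nonempty := fun ⟨i, hi⟩ => hi (hv i)
    simp only [J, dif_neg h]

/-- On a finite conjugation invariant set `V`, a polynomial that is nonnegative at the real points
of `V` where all `g i` are nonnegative agrees with an element of the quadratic module generated by
the `g i`.  At a real point either the value itself or its quotient by some `g i` is a square; at
a nonreal point `p = ((p + 1) / 2) ^ 2 + (J * (p - 1) / 2) ^ 2` where `J ^ 2 = -1`. -/
theorem exists_quadraticModule_interpolation {ι : Type*} [Fintype ι] (V : Finset (σ → ℂ))
    (hV : ∀ v ∈ V, (fun i => conj (v i)) ∈ V) (g : ι → MvPolynomial σ ℝ) (p : MvPolynomial σ ℝ)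
    (hp : ∀ u : σ → ℝ, (fun i => (u i : ℂ)) ∈ V → (∀ i, 0 ≤ eval u (g i)) → 0 ≤ eval u p) :
    ∃ (a b : MvPolynomial σ ℝ) (c : ι → MvPolynomial σ ℝ), a.totalDegree ≤ V.card ∧
      b.totalDegree ≤ V.card ∧ (∀ i, (c i).totalDegree ≤ V.card) ∧
      ∀ v ∈ V, aeval v (a ^ 2 + b ^ 2 + ∑ i, g i * c i ^ 2) = aeval v p := by
  classical
  obtain ⟨J, hJconj, hJsq, hJreal⟩ := exists_equivariant_I (σ := σ)
  have hreal : ∀ v : σ → ℂ, (∀ i, (v i).im = 0) →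
      ∃ u : σ → ℝ, v = fun i => (u i : ℂ) := fun v hv =>
    ⟨fun i => (v i).re, funext fun i => Complex.ext (by simp) (by simp [hv i])⟩
  have hconj : ∀ v : σ → ℂ, (∀ i, (v i).im = 0) → (fun i => conj (v i)) = v := fun v hv =>
    funext fun i => Complex.conj_eq_iff_im.2 (hv i)
  have hw : ∀ v : σ → ℂ, ∃ w : ι → ℝ,
      (v ∈ V → (∀ i, (v i).im = 0) → (aeval v p).re < 0 →
        ∑ i, (aeval v (g i)).re * w i ^ 2 = (aeval v p).re) ∧
      (¬ ((∀ i, (v i).im = 0) ∧ (aeval v p).re < 0) → w = 0) := by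
    intro v
    by_cases h : v ∈ V ∧ (∀ i, (v i).im = 0) ∧ (aeval v p).re < 0
    · obtain ⟨hvV, hv, hneg⟩ := h
      obtain ⟨u, rfl⟩ := hreal v hv
      have hi : ∃ i, eval u (g i) < 0 := by
        by_contra! hcon
        have := hp u hvV hcon
        rw [aeval_ofReal, Complex.ofReal_re] at hneg
        exact absurd this (not_le.2 hneg)
      obtain ⟨i, hi⟩ := hi
      rw [aeval_ofReal, Complex.ofReal_re] at hneg
      refine ⟨Pi.single i √(eval u p / eval u (g i)), fun _ _ _ => ?_, fun hn => ?_⟩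
      · rw [Finset.sum_eq_single i]
        · rw [Pi.single_eq_same, Real.sq_sqrt (div_nonneg_of_nonpos hneg.le hi.le),
            aeval_ofReal, aeval_ofReal, Complex.ofReal_re, Complex.ofReal_re,
            mul_div_cancel₀ _ hi.ne]
        · intro j _ hj
          simp [Pi.single_eq_of_ne hj]
        · simp
      · exact absurd ⟨hv, by rwa [aeval_ofReal, Complex.ofReal_re]⟩ hn
    · exact ⟨0, fun h1 h2 h3 => absurd ⟨h1, h2, h3⟩ h, fun _ => rfl⟩
  choose w hw hw0 using hw
  -- `Real.sqrt` vanishes at negative arguments, so `a` contributes nothing where `p < 0`.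
  obtain ⟨a, hadeg, ha⟩ := exists_real_interpolation V hV
    (fun v => if ∀ i, (v i).im = 0 then ((√(aeval v p).re : ℝ) : ℂ) else (aeval v p + 1) / 2)
    (fun v => by
      by_cases h : ∀ i, (v i).im = 0
      · simp [hconj v h, h]
      · simp only [if_neg h, Complex.conj_im, neg_eq_zero, aeval_conj, map_div₀, map_add, map_one,
          map_ofNat])
  obtain ⟨b, hbdeg, hb⟩ := exists_real_interpolation V hV
    (fun v => J v * (aeval v p - 1) / 2)
    (fun v => by
      simp only [hJconj, aeval_conj, map_div₀, map_mul, map_sub, map_one, map_ofNat])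
  have hc := fun i => exists_real_interpolation V hV (fun v => (w v i : ℂ)) (fun v => by
      by_cases h : ∀ i, (v i).im = 0
      · simp [hconj v h]
      · rw [hw0 v fun h' => h h'.1, hw0 _ fun h' => h fun i => by simpa using h'.1 i]
        simp)
  choose c hcdeg hc using hc
  refine ⟨a, b, c, hadeg, hbdeg, hcdeg, fun v hv => ?_⟩
  simp only [map_add, map_pow, map_sum, map_mul, ha v hv, hb v hv, hc _ v hv]
  by_cases h : ∀ i, (v i).im = 0
  · have hsum : ∑ i, aeval v (g i) * (w v i : ℂ) ^ 2 =
        ((∑ i, (aeval v (g i)).re * w v i ^ 2 : ℝ) : ℂ) := by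
      obtain ⟨u, rfl⟩ := hreal v h
      simp [aeval_ofReal]
    have hpv : aeval v p = ((aeval v p).re : ℂ) := by
      obtain ⟨u, rfl⟩ := hreal v h
      simp [aeval_ofReal]
    rw [if_pos h, hJreal v h, hsum]
    by_cases hneg : (aeval v p).re < 0
    · rw [hw v hv h hneg, Real.sqrt_eq_zero'.2 hneg.le, ← hpv]
      simp
    · rw [hw0 v fun h' => hneg h'.2, ← Complex.ofReal_pow, Real.sq_sqrt (not_lt.1 hneg), ← hpv]
      simp
  · rw [if_neg h, hw0 v fun h' => h h'.1]
    have hJ := hJsq v (by simpa using h)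
    simp only [Pi.zero_apply, Complex.ofReal_zero, ne_eq, OfNat.ofNat_ne_zero, not_false_eq_true,
      zero_pow, mul_zero, Finset.sum_const_zero, add_zero]
    linear_combination ((aeval v p - 1) / 2) ^ 2 * hJ

end Interpolation

/-! ### Certificates of nonnegativity of bounded degree -/

section Certificate

variable {σ : Type*}

open ComplexConjugate

theorem IsSOS.mono {k l : ℕ} (h : k ≤ l) {p : MvPolynomial σ ℝ} (hp : IsSOS k p) : IsSOS l p := by
  obtain ⟨r, u, hu, rfl⟩ := hp
  exact ⟨r, u, fun i => (hu i).trans h, rfl⟩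

theorem isSOS_sq {k : ℕ} {p : MvPolynomial σ ℝ} (hp : p.totalDegree ≤ k) : IsSOS k (p ^ 2) :=
  ⟨1, fun _ => p, fun _ => hp, by simp⟩

theorem IsSOS.add {k : ℕ} {p q : MvPolynomial σ ℝ} (hp : IsSOS k p) (hq : IsSOS k q) :
    IsSOS k (p + q) := by
  obtain ⟨r, u, hu, rfl⟩ := hp
  obtain ⟨r', u', hu', rfl⟩ := hq
  refine ⟨r + r', Fin.append u u', fun l => ?_, ?_⟩
  · induction l using Fin.addCases with
    | left i => simpa using hu i
    | right i => simpa using hu' i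
  · simp [Fin.sum_univ_add]

/-- The Taylor polynomials at the origin of the square root of `ε + t`. -/
theorem exists_sqrt_truncation {ε : ℝ} (hε : 0 < ε) (k : ℕ) :
    ∃ s : Polynomial ℝ, s.natDegree ≤ k ∧ s.coeff 0 ≠ 0 ∧
      Polynomial.X ^ (k + 1) ∣ s ^ 2 - (Polynomial.C ε + Polynomial.X) := by
  induction k with
  | zero =>
    refine ⟨Polynomial.C √ε, by simp, by simpa using (Real.sqrt_pos.2 hε).ne', -1, ?_⟩
    rw [← Polynomial.C_pow, Real.sq_sqrt hε.le]
    ring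
  | succ k ih =>
    obtain ⟨s, hdeg, hs, r, hr⟩ := ih
    -- The next coefficient `c` solves `2 * s 0 * c + r 0 = 0`.
    set c := -(r.coeff 0) / (2 * s.coeff 0) with hc
    have hdvd : Polynomial.X ∣
        r + 2 * Polynomial.C c * s + Polynomial.C c ^ 2 * Polynomial.X ^ (k + 1) := by
      rw [Polynomial.X_dvd_iff]
      simp only [Polynomial.coeff_zero_eq_eval_zero, Polynomial.eval_add, Polynomial.eval_mul,
        Polynomial.eval_pow, Polynomial.eval_X, Polynomial.eval_C, Polynomial.eval_ofNat] at hs hc ⊢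
      rw [hc, zero_pow k.succ_ne_zero]
      field_simp
      ring
    obtain ⟨t, ht⟩ := hdvd
    refine ⟨s + Polynomial.C c * Polynomial.X ^ (k + 1), ?_, ?_, t, ?_⟩
    · refine Polynomial.natDegree_add_le_of_degree_le (hdeg.trans k.le_succ) ?_
      exact Polynomial.natDegree_C_mul_X_pow_le _ _
    · simpa using hs
    · rw [pow_succ Polynomial.X (k + 1), mul_assoc, ← ht]
      linear_combination hr

theorem totalDegree_aeval_le (s : Polynomial ℝ) (q : MvPolynomial σ ℝ) :
    (Polynomial.aeval q s).totalDegree ≤ s.natDegree * q.totalDegree := by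
  rw [Polynomial.aeval_eq_sum_range]
  refine totalDegree_finsetSum_le fun i hi => (totalDegree_smul_le _ _).trans ?_
  refine (totalDegree_pow _ _).trans (Nat.mul_le_mul_right _ ?_)
  exact Nat.lt_succ_iff.1 (Finset.mem_range.1 hi)

/-- Elements of bounded degree of a finitely generated ideal have representations by the generators
with coefficients of bounded degree, since they form a finite dimensional space. -/
theorem exists_totalDegree_bound_span [Finite σ] {κ : Type*} [Fintype κ]
    (e : κ → MvPolynomial σ ℝ) (d : ℕ) :
    ∃ M : ℕ, ∀ q ∈ Ideal.span (Set.range e), q.totalDegree ≤ d →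
      ∃ r : κ → MvPolynomial σ ℝ, (∀ j, (r j).totalDegree ≤ M) ∧ q = ∑ j, r j * e j := by
  classical
  let W : Submodule ℝ (MvPolynomial σ ℝ) :=
    restrictTotalDegree σ ℝ d ⊓ (Ideal.span (Set.range e)).restrictScalars ℝ
  have hfin : FiniteDimensional ℝ W := Submodule.finiteDimensional_of_le
    (S₂ := restrictTotalDegree σ ℝ d) inf_le_left
  obtain ⟨S, hS⟩ := (Submodule.fg_iff_finiteDimensional W).2 hfin
  have hrep : ∀ q ∈ Ideal.span (Set.range e), ∃ r : κ → MvPolynomial σ ℝ, ∑ j, r j * e j = q :=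
    fun q hq => Ideal.mem_span_range_iff_exists_fun.1 hq
  choose! r hr using hrep
  refine ⟨S.sup fun q => Finset.univ.sup fun j => (r q j).totalDegree, fun q hq hdeg => ?_⟩
  have hqW : q ∈ Submodule.span ℝ (S : Set (MvPolynomial σ ℝ)) := by
    rw [hS]
    exact ⟨(mem_restrictTotalDegree _ _ _).2 hdeg, hq⟩
  clear hq hdeg
  induction hqW using Submodule.span_induction with
  | mem q hqS =>
    have hqI : q ∈ Ideal.span (Set.range e) := by
      have : q ∈ W := hS ▸ Submodule.subset_span hqS
      exact this.2
    refine ⟨r q, fun j => ?_, (hr q hqI).symm⟩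
    refine le_trans ?_ (Finset.le_sup (f := fun q => Finset.univ.sup fun j =>
      (r q j).totalDegree) hqS)
    exact Finset.le_sup (f := fun j => (r q j).totalDegree) (Finset.mem_univ j)
  | zero => exact ⟨0, by simp, by simp⟩
  | add p q _ _ hp hq =>
    obtain ⟨rp, hrp, hp⟩ := hp
    obtain ⟨rq, hrq, hq⟩ := hq
    refine ⟨rp + rq, fun j => (totalDegree_add _ _).trans (max_le (hrp j) (hrq j)), ?_⟩
    simp [hp, hq, add_mul, Finset.sum_add_distrib]
  | smul a p _ hp =>
    obtain ⟨rp, hrp, hp⟩ := hp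
    refine ⟨a • rp, fun j => (totalDegree_smul_le _ _).trans (hrp j), ?_⟩
    simp [hp, Finset.smul_sum]

/-- A polynomial `p` that is nonnegative on the real points with `e j = 0` and `0 ≤ g i` lies, up
to adding an arbitrarily small positive constant, in the quadratic module generated by the `g i`
and the ideal of the `e j`, provided that ideal has finitely many complex zeros.  The degrees in
the representation are bounded in terms of the degree of `p` alone. -/
theorem exists_certificate [Finite σ] {ι κ : Type*} [Fintype ι] [Fintype κ]
    (g : ι → MvPolynomial σ ℝ) (e : κ → MvPolynomial σ ℝ)
    (hfin : (zeroLocus ℂ (Ideal.span (Set.range e))).Finite) (d : ℕ) :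
    ∃ M : ℕ, ∀ p : MvPolynomial σ ℝ, p.totalDegree ≤ d →
      (∀ v : σ → ℝ, (∀ j, eval v (e j) = 0) → (∀ i, 0 ≤ eval v (g i)) → 0 ≤ eval v p) →
      ∀ ε : ℝ, 0 < ε → ∃ (s : MvPolynomial σ ℝ) (t : ι → MvPolynomial σ ℝ)
        (r : κ → MvPolynomial σ ℝ), IsSOS M s ∧ (∀ i, IsSOS M (t i)) ∧
        (∀ j, (r j).totalDegree ≤ M) ∧ p + C ε = s + ∑ i, g i * t i + ∑ j, r j * e j := by
  classical
  set I := Ideal.span (Set.range e)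
  obtain ⟨k, hk⟩ := I.exists_radical_pow_le_of_fg I.radical.fg_of_isNoetherianRing
  have hV : ∀ v, v ∈ hfin.toFinset ↔ ∀ j, aeval v (e j) = 0 := fun v => by
    rw [Set.Finite.mem_toFinset, zeroLocus_span]
    simp
  have hVconj : ∀ v ∈ hfin.toFinset, (fun i => conj (v i)) ∈ hfin.toFinset := fun v hv => by
    rw [hV] at hv ⊢
    exact fun j => by rw [aeval_conj, hv j, map_zero]
  set c := hfin.toFinset.card
  -- `d'` bounds the degree of the nilpotent remainder `q`, and `k * d'` that of the square root.
  set d' := d + (2 * c + Finset.univ.sup fun i => (g i).totalDegree) with hd'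
  obtain ⟨M, hM⟩ := exists_totalDegree_bound_span e (2 * (k * d') + d')
  refine ⟨c + k * d' + M, fun p hpd hp ε hε => ?_⟩
  obtain ⟨a, b, t, ha, hb, ht, heq⟩ := exists_quadraticModule_interpolation hfin.toFinset hVconj g p
    (fun u hu hg => hp u (fun j => by
      have := (hV _).1 hu j
      rw [aeval_ofReal] at this
      exact_mod_cast this) hg)
  set q := p - (a ^ 2 + b ^ 2 + ∑ i, g i * t i ^ 2) with hq
  have hqrad : q ∈ I.radical := by
    rw [← vanishingIdeal_zeroLocus_eq_radical (K := ℂ), mem_vanishingIdeal_iff]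
    intro v hv
    rw [hq, map_sub, heq v (hfin.mem_toFinset.2 hv), sub_self]
  have hsq : ∀ {u : MvPolynomial σ ℝ} {l : ℕ}, u.totalDegree ≤ l →
      (u ^ 2).totalDegree ≤ 2 * l := fun {u l} h =>
    (totalDegree_pow _ _).trans (Nat.mul_le_mul_left _ h)
  have hqdeg : q.totalDegree ≤ d' := by
    refine (totalDegree_sub _ _).trans (max_le (by omega) ?_)
    refine (totalDegree_add _ _).trans (max_le ((totalDegree_add _ _).trans (max_le ?_ ?_)) ?_)
    · exact (hsq ha).trans (by omega)
    · exact (hsq hb).trans (by omega)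
    · refine totalDegree_finsetSum_le fun i _ => (totalDegree_mul _ _).trans ?_
      have h1 := hsq (ht i)
      have h2 : (g i).totalDegree ≤ Finset.univ.sup fun i => (g i).totalDegree :=
        Finset.le_sup (f := fun i => (g i).totalDegree) (Finset.mem_univ i)
      omega
  obtain ⟨s, hsdeg, -, hdvd⟩ := exists_sqrt_truncation hε k
  have hsqdeg : (Polynomial.aeval q s).totalDegree ≤ k * d' :=
    (totalDegree_aeval_le s q).trans (Nat.mul_le_mul hsdeg hqdeg)
  have hmem : (Polynomial.aeval q s) ^ 2 - (C ε + q) ∈ I := by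
    have h := map_dvd (Polynomial.aeval q) hdvd
    simp only [map_pow, map_sub, map_add, Polynomial.aeval_X, Polynomial.aeval_C,
      algebraMap_eq] at h
    refine I.mem_of_dvd h ?_
    rw [pow_succ]
    exact I.mul_mem_right _ (hk (Ideal.pow_mem_pow hqrad k))
  obtain ⟨r, hr, hreq⟩ := hM _ hmem (by
    refine (totalDegree_sub _ _).trans (max_le ((hsq hsqdeg).trans (by omega)) ?_)
    refine (totalDegree_add _ _).trans (max_le ?_ (by omega))
    simp)
  refine ⟨a ^ 2 + b ^ 2 + (Polynomial.aeval q s) ^ 2, fun i => t i ^ 2, fun j => -r j,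
    ((isSOS_sq (ha.trans (by omega))).add (isSOS_sq (hb.trans (by omega)))).add
      (isSOS_sq (hsqdeg.trans (by omega))), fun i => isSOS_sq ((ht i).trans (by omega)),
    fun j => ?_, ?_⟩
  · rw [totalDegree_neg]
    exact (hr j).trans (by omega)
  · simp only [neg_mul, Finset.sum_neg_distrib]
    rw [← hreq, hq]
    ring

end Certificate

/-! ### Moment matrices as quadratic forms on polynomials -/

section MomentForms

variable {σ : Type*} {N : ℕ}

/-- `riesz y` as a linear functional on all polynomials. -/
def rieszHom (y : MomentVec σ N) : MvPolynomial σ ℝ →ₗ[ℝ] ℝ :=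
  (basisMonomials σ ℝ).constr ℝ y.entry

theorem riesz_eq_rieszHom (y : MomentVec σ N) (p : MvPolynomial σ ℝ) :
    riesz y p = rieszHom y p := by
  rw [rieszHom, Module.Basis.constr_apply]
  rfl

theorem rieszHom_monomial (y : MomentVec σ N) (α : σ →₀ ℕ) (a : ℝ) :
    rieszHom y (monomial α a) = a * y.entry α := by
  rw [← mul_one a, ← smul_eq_mul, ← smul_monomial, map_smul, rieszHom,
    ← congrFun (coe_basisMonomials σ ℝ) α, Module.Basis.constr_basis]
  simp

theorem rieszHom_C (y : MomentVec σ N) (a : ℝ) : rieszHom y (C a) = a * y.entry 0 :=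
  rieszHom_monomial y 0 a

theorem monomial_eq_smul_one (α : σ →₀ ℕ) (a : ℝ) :
    monomial α a = a • monomial α (1 : ℝ) := by
  rw [smul_monomial, smul_eq_mul, mul_one]

theorem localizing_apply (k : ℕ) (p : MvPolynomial σ ℝ) (y : MomentVec σ N) (β γ : MIdx σ k) :
    localizing k p y β γ = rieszHom y (p * (monomial β.1 1 * monomial γ.1 1)) := by
  conv_rhs => rw [← support_sum_monomial_coeff p]
  rw [Finset.sum_mul, map_sum]
  refine Finset.sum_congr rfl fun α _ => ?_
  rw [monomial_mul, monomial_mul, rieszHom_monomial, mul_one, mul_one, add_assoc]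

theorem hankel_eq_localizing_one (k : ℕ) (y : MomentVec σ N) :
    hankel k y = localizing k 1 y := by
  ext β γ
  rw [localizing_apply, one_mul, monomial_mul, rieszHom_monomial, mul_one, one_mul]
  rfl

theorem localizing_isHermitian (k : ℕ) (p : MvPolynomial σ ℝ) (y : MomentVec σ N) :
    (localizing k p y).IsHermitian := by
  ext β γ
  rw [Matrix.conjTranspose_apply, star_trivial, localizing_apply, localizing_apply,
    mul_comm (monomial β.1 1)]

theorem localizing_eq_zero_iff {k : ℕ} (p : MvPolynomial σ ℝ) (y : MomentVec σ N) :
    localizing k p y = 0 ↔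
      ∀ q : MvPolynomial σ ℝ, q.totalDegree ≤ 2 * k → rieszHom y (q * p) = 0 := by
  refine ⟨fun h q hq => ?_, fun h => ?_⟩
  · rw [← support_sum_monomial_coeff q, Finset.sum_mul, map_sum]
    refine Finset.sum_eq_zero fun α hα => ?_
    have hdeg : α.degree ≤ 2 * k := (le_totalDegree hα).trans hq
    -- A monomial of degree at most `2 k` splits into two monomials of degree at most `k`.
    obtain ⟨β, hβ, hβdeg⟩ := Finsupp.exists_le_degree_eq α (min k α.degree) (min_le_right _ _)
    obtain ⟨γ, rfl⟩ := exists_add_of_le hβ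
    rw [map_add] at hdeg hβdeg
    have h0 := congrFun (congrFun h ⟨β, by omega⟩) ⟨γ, by omega⟩
    rw [localizing_apply, monomial_mul, one_mul] at h0
    rw [monomial_eq_smul_one, smul_mul_assoc, map_smul, mul_comm, h0]
    exact smul_zero _
  · ext β γ
    rw [localizing_apply, mul_comm]
    refine h _ ?_
    rw [monomial_mul]
    refine (totalDegree_monomial_le _ _).trans ?_
    have h1 := β.2
    have h2 := γ.2
    change (β.1 + γ.1).degree ≤ 2 * k
    rw [map_add]
    omega

theorem rieszHom_average (y y' : MomentVec σ N) (p : MvPolynomial σ ℝ) :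
    rieszHom ((2⁻¹ : ℝ) • (y + y')) p = (rieszHom y p + rieszHom y' p) / 2 := by
  rw [← riesz_eq_rieszHom, ← riesz_eq_rieszHom, ← riesz_eq_rieszHom, riesz, riesz, riesz,
    ← Finset.sum_add_distrib, Finset.sum_div]
  refine Finset.sum_congr rfl fun α _ => ?_
  simp only [MomentVec.entry]
  split_ifs
  · simp only [Pi.smul_apply, Pi.add_apply, smul_eq_mul]
    ring
  · simp

/-- The moment vector of the Dirac measure at `u`. -/
def diracMoments (N : ℕ) (u : σ → ℝ) : MomentVec σ N := fun α => eval u (monomial α.1 1)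

theorem rieszHom_diracMoments (u : σ → ℝ) {p : MvPolynomial σ ℝ} (hp : p.totalDegree ≤ 2 * N) :
    rieszHom (diracMoments N u) p = eval u p := by
  conv_rhs => rw [← support_sum_monomial_coeff p]
  rw [← riesz_eq_rieszHom, riesz, map_sum]
  refine Finset.sum_congr rfl fun α hα => ?_
  have hdeg : α.degree ≤ 2 * N := (le_totalDegree hα).trans hp
  rw [MomentVec.entry, dif_pos hdeg]
  simp [diracMoments, eval_monomial]

variable [Finite σ]

theorem totalDegree_polyOfVec_le {k : ℕ} (c : MIdx σ k → ℝ) : (polyOfVec c).totalDegree ≤ k :=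
  totalDegree_finsetSum_le fun α _ => (totalDegree_monomial_le _ _).trans α.2

theorem coeff_polyOfVec {k : ℕ} (c : MIdx σ k → ℝ) (α : MIdx σ k) :
    coeff α.1 (polyOfVec c) = c α := by
  classical
  rw [polyOfVec, coeff_sum, Finset.sum_eq_single α]
  · simp
  · intro β _ hβ
    rw [coeff_monomial, if_neg fun h => hβ (Subtype.ext h)]
  · simp

theorem exists_polyOfVec_eq {k : ℕ} {p : MvPolynomial σ ℝ} (hp : p.totalDegree ≤ k) :
    ∃ c : MIdx σ k → ℝ, polyOfVec c = p := by
  classical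
  refine ⟨fun α => coeff α.1 p, ?_⟩
  ext α
  by_cases hα : α.degree ≤ k
  · exact coeff_polyOfVec _ ⟨α, hα⟩
  · have h : ∀ q : MvPolynomial σ ℝ, q.totalDegree ≤ k → coeff α q = 0 := fun q hq =>
      notMem_support_iff.1 fun h => hα ((le_totalDegree h).trans hq)
    rw [h _ (totalDegree_polyOfVec_le _), h _ hp]

theorem dotProduct_localizing_mulVec {k : ℕ} (p : MvPolynomial σ ℝ) (y : MomentVec σ N)
    (c c' : MIdx σ k → ℝ) :
    c ⬝ᵥ (localizing k p y).mulVec c' = rieszHom y (p * (polyOfVec c * polyOfVec c')) := by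
  rw [polyOfVec, polyOfVec, Finset.sum_mul_sum]
  simp only [Finset.mul_sum, map_sum, dotProduct, Matrix.mulVec]
  refine Finset.sum_congr rfl fun β _ => Finset.sum_congr rfl fun γ _ => ?_
  rw [localizing_apply, monomial_eq_smul_one β.1 (c β), monomial_eq_smul_one γ.1 (c' γ)]
  simp only [smul_mul_assoc, mul_smul_comm, map_smul, smul_eq_mul]
  ring

theorem localizing_posSemidef_iff {k : ℕ} (p : MvPolynomial σ ℝ) (y : MomentVec σ N) :
    (localizing k p y).PosSemidef ↔
      ∀ u : MvPolynomial σ ℝ, u.totalDegree ≤ k → 0 ≤ rieszHom y (p * u ^ 2) := by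
  rw [Matrix.posSemidef_iff_dotProduct_mulVec]
  refine ⟨fun h u hu => ?_, fun h => ⟨localizing_isHermitian k p y, fun c => ?_⟩⟩
  · obtain ⟨c, rfl⟩ := exists_polyOfVec_eq hu
    rw [sq, ← dotProduct_localizing_mulVec]
    simpa using h.2 c
  · rw [star_trivial, dotProduct_localizing_mulVec, ← sq]
    exact h _ (totalDegree_polyOfVec_le c)

theorem hankel_mulVec_eq_zero_iff {k : ℕ} (y : MomentVec σ N) (c : MIdx σ k → ℝ) :
    (hankel k y).mulVec c = 0 ↔
      ∀ q : MvPolynomial σ ℝ, q.totalDegree ≤ k → rieszHom y (q * polyOfVec c) = 0 := by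
  rw [hankel_eq_localizing_one]
  refine ⟨fun h q hq => ?_, fun h => ?_⟩
  · obtain ⟨c', rfl⟩ := exists_polyOfVec_eq hq
    rw [← one_mul (_ * _), ← dotProduct_localizing_mulVec, h, dotProduct_zero]
  · refine dotProduct_eq_zero _ fun c' => ?_
    rw [dotProduct_comm, dotProduct_localizing_mulVec, one_mul]
    exact h _ (totalDegree_polyOfVec_le c')

theorem hankel_mulVec_eq_zero_iff_of_posSemidef {k : ℕ} {y : MomentVec σ N}
    (hy : (hankel k y).PosSemidef) (c : MIdx σ k → ℝ) :
    (hankel k y).mulVec c = 0 ↔ rieszHom y (polyOfVec c ^ 2) = 0 := by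
  rw [← hy.dotProduct_mulVec_zero_iff, star_trivial, hankel_eq_localizing_one,
    dotProduct_localizing_mulVec, one_mul, sq]

end MomentForms

/-! ### Duality between the two hierarchies -/

section Duality

variable {n m : ℕ} {A : Matrix (Fin n) (Fin n) ℝ} {B : Matrix (Fin n) (Fin m) ℝ}
  {C : Matrix (Fin m) (Fin n) ℝ} {D : Matrix (Fin m) (Fin m) ℝ} {N : ℕ}

theorem momFeasible_iff {y : MomentVec (Var n m) N} : MomFeasible A B C D N y ↔
    rieszHom y 1 = 1 ∧
    (∀ u : MvPolynomial (Var n m) ℝ, u.totalDegree ≤ N → 0 ≤ rieszHom y (u ^ 2)) ∧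
    (∀ e, ∀ q : MvPolynomial (Var n m) ℝ, q.totalDegree ≤ 2 * (N - 1) →
      rieszHom y (q * ePoly A B C D e) = 0) ∧
    (∀ u : MvPolynomial (Var n m) ℝ, u.totalDegree ≤ N - 1 → 0 ≤ rieszHom y (lamVar * u ^ 2)) ∧
    ∀ g, ∀ u : MvPolynomial (Var n m) ℝ, u.totalDegree ≤ N - 1 →
      0 ≤ rieszHom y (gPoly C D g * u ^ 2) := by
  have h1 : rieszHom y 1 = y.entry 0 := by
    rw [← MvPolynomial.C_1, rieszHom_C, one_mul]
  constructor
  · rintro ⟨h0, hH, he, hl, hg⟩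
    refine ⟨h1.trans h0, fun u hu => ?_, fun e => (localizing_eq_zero_iff _ y).1 (he e),
      (localizing_posSemidef_iff _ y).1 hl, fun g => (localizing_posSemidef_iff _ y).1 (hg g)⟩
    rw [← one_mul (u ^ 2)]
    rw [hankel_eq_localizing_one] at hH
    exact (localizing_posSemidef_iff _ y).1 hH u hu
  · rintro ⟨h0, hH, he, hl, hg⟩
    refine ⟨h1.symm.trans h0, ?_, fun e => (localizing_eq_zero_iff _ y).2 (he e),
      (localizing_posSemidef_iff _ y).2 hl, fun g => (localizing_posSemidef_iff _ y).2 (hg g)⟩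
    rw [hankel_eq_localizing_one]
    exact (localizing_posSemidef_iff _ y).2 fun u hu => by simpa using hH u hu

theorem MomFeasible.average {y y' : MomentVec (Var n m) N} (hy : MomFeasible A B C D N y)
    (hy' : MomFeasible A B C D N y') : MomFeasible A B C D N ((2⁻¹ : ℝ) • (y + y')) := by
  rw [momFeasible_iff] at *
  obtain ⟨h0, hH, he, hl, hg⟩ := hy
  obtain ⟨h0', hH', he', hl', hg'⟩ := hy'
  simp only [rieszHom_average]
  refine ⟨by rw [h0, h0']; norm_num, fun u hu => ?_, fun e q hq => ?_, fun u hu => ?_,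
    fun g u hu => ?_⟩
  · linarith [hH u hu, hH' u hu]
  · rw [he e q hq, he' e q hq]; norm_num
  · linarith [hl u hu, hl' u hu]
  · linarith [hg g u hu, hg' g u hu]

theorem totalDegree_linear_le {σ ι : Type*} [Fintype ι] (c : ι → ℝ) (p : ι → σ) :
    (∑ k, MvPolynomial.C (c k) * X (p k) : MvPolynomial σ ℝ).totalDegree ≤ 1 :=
  totalDegree_finsetSum_le fun k _ => (totalDegree_mul _ _).trans (by simp)

theorem totalDegree_zPoly_le (j : Fin m) : (zPoly C D j).totalDegree ≤ 1 :=
  (totalDegree_add _ _).trans (max_le (totalDegree_linear_le _ _) (totalDegree_linear_le _ _))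

theorem totalDegree_wVar (j : Fin m) : (wVar (n := n) j).totalDegree ≤ 1 :=
  (totalDegree_X _).le

theorem totalDegree_mul_le_two {σ : Type*} {p q : MvPolynomial σ ℝ} (hp : p.totalDegree ≤ 1)
    (hq : q.totalDegree ≤ 1) : (p * q).totalDegree ≤ 2 :=
  (totalDegree_mul _ _).trans (add_le_add hp hq)

theorem totalDegree_sub_le_of_le {σ : Type*} {p q : MvPolynomial σ ℝ} {k : ℕ}
    (hp : p.totalDegree ≤ k) (hq : q.totalDegree ≤ k) : (p - q).totalDegree ≤ k :=
  (totalDegree_sub _ _).trans (max_le hp hq)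

theorem totalDegree_ePoly_le (e : EqIdx n m) : (ePoly A B C D e).totalDegree ≤ 2 := by
  rcases e with i | j | _
  · refine totalDegree_sub_le_of_le ((totalDegree_add _ _).trans (max_le ?_ ?_)) ?_
    · exact (totalDegree_linear_le _ _).trans one_le_two
    · exact (totalDegree_linear_le _ _).trans one_le_two
    · exact totalDegree_mul_le_two (totalDegree_X _).le (totalDegree_X _).le
  · refine totalDegree_sub_le_of_le
      (totalDegree_mul_le_two (totalDegree_wVar j) (totalDegree_zPoly_le j)) ?_
    rw [sq]
    exact totalDegree_mul_le_two (totalDegree_wVar j) (totalDegree_wVar j)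
  · refine totalDegree_sub_le_of_le ((totalDegree_add _ _).trans (max_le ?_ ?_)) (by simp)
    all_goals
      refine totalDegree_finsetSum_le fun i _ => ?_
      exact (totalDegree_pow _ _).trans (by simp [xVar, wVar])

theorem totalDegree_gPoly_le (g : IneqIdx m) : (gPoly (n := n) C D g).totalDegree ≤ 2 := by
  rcases g with ⟨i, j⟩ | ⟨i, j⟩ | ⟨i, j⟩
  · exact totalDegree_mul_le_two (totalDegree_wVar i) (totalDegree_wVar j)
  · exact totalDegree_sub_le_of_le
      (totalDegree_mul_le_two (totalDegree_wVar j) (totalDegree_wVar i))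
      (totalDegree_mul_le_two (totalDegree_wVar j) (totalDegree_zPoly_le i))
  · exact totalDegree_mul_le_two
      (totalDegree_sub_le_of_le (totalDegree_wVar i) (totalDegree_zPoly_le i))
      (totalDegree_sub_le_of_le (totalDegree_wVar j) (totalDegree_zPoly_le j))

theorem momFeasible_diracMoments (hN : 1 ≤ N) {v : Var n m → ℝ}
    (hv : v ∈ feasibleSet A B C D) : MomFeasible A B C D N (diracMoments N v) := by
  obtain ⟨he, hl, hg⟩ := hv
  have hdeg : ∀ {p u : MvPolynomial (Var n m) ℝ}, p.totalDegree ≤ 2 → u.totalDegree ≤ N - 1 →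
      (p * u ^ 2).totalDegree ≤ 2 * N := fun {p u} hp hu => by
    have h1 := totalDegree_mul p (u ^ 2)
    have h2 := totalDegree_pow u 2
    omega
  rw [momFeasible_iff]
  refine ⟨?_, fun u hu => ?_, fun e q hq => ?_, fun u hu => ?_, fun g u hu => ?_⟩
  · rw [rieszHom_diracMoments v (by simp), map_one]
  · rw [rieszHom_diracMoments v ((totalDegree_pow _ _).trans (Nat.mul_le_mul_left _ hu)), map_pow]
    positivity
  · rw [rieszHom_diracMoments v, map_mul, he e, mul_zero]
    have h1 := totalDegree_mul q (ePoly A B C D e)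
    have h2 := totalDegree_ePoly_le (A := A) (B := B) (C := C) (D := D) e
    omega
  · have hlam : (lamVar : MvPolynomial (Var n m) ℝ).totalDegree ≤ 2 :=
      (totalDegree_X _).trans_le one_le_two
    rw [rieszHom_diracMoments v (hdeg hlam hu), map_mul, map_pow]
    exact mul_nonneg hl (sq_nonneg _)
  · rw [rieszHom_diracMoments v (hdeg (totalDegree_gPoly_le g) hu), map_mul, map_pow]
    exact mul_nonneg (hg g) (sq_nonneg _)

theorem le_rieszHom_of_sosFeasible {y : MomentVec (Var n m) N} (hy : MomFeasible A B C D N y)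
    {f : MvPolynomial (Var n m) ℝ} {ρ : ℝ} (hρ : SosFeasible A B C D f N ρ) :
    ρ ≤ rieszHom y f := by
  have hnorm := hy.normalized
  obtain ⟨-, hH, he, hl, hg⟩ := momFeasible_iff.1 hy
  obtain ⟨s₀, sl, sg, p, ⟨r, u, hu, rfl⟩, ⟨r', u', hu', rfl⟩, hsg, hp, heq⟩ := hρ
  have h := congrArg (rieszHom y) heq
  have h1 : 0 ≤ rieszHom y (∑ l, u l ^ 2) := by
    rw [map_sum]
    exact Finset.sum_nonneg fun l _ => hH _ (hu l)
  have h2 : 0 ≤ rieszHom y (lamVar * ∑ l, u' l ^ 2) := by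
    rw [Finset.mul_sum, map_sum]
    exact Finset.sum_nonneg fun l _ => hl _ (hu' l)
  have h3 : 0 ≤ rieszHom y (∑ g, gPoly C D g * sg g) := by
    rw [map_sum]
    refine Finset.sum_nonneg fun g _ => ?_
    obtain ⟨k, w, hw, hk⟩ := hsg g
    rw [hk, Finset.mul_sum, map_sum]
    exact Finset.sum_nonneg fun l _ => hg g _ (hw l)
  have h4 : rieszHom y (∑ e, p e * ePoly A B C D e) = 0 := by
    rw [map_sum]
    exact Finset.sum_eq_zero fun e _ => he e _ ((hp e).trans (by omega))
  rw [map_sub, rieszHom_C, hnorm, mul_one, map_add, map_add, map_add, h4] at h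
  linarith

/-- Eventual feasibility of the sum of squares relaxation for all polynomials of degree at most `d`
that are nonnegative on the feasible set, up to an arbitrarily small constant. -/
theorem exists_forall_sosFeasible (hI : IsZeroDimensional (eqIdeal A B C D)) (d : ℕ) :
    ∃ N₀ : ℕ, ∀ N, N₀ ≤ N → ∀ p : MvPolynomial (Var n m) ℝ, p.totalDegree ≤ d →
      (∀ v ∈ feasibleSet A B C D, 0 ≤ eval v p) → ∀ ε : ℝ, 0 < ε →
        SosFeasible A B C D p N (-ε) := by
  obtain ⟨M, hM⟩ := exists_certificate
    (fun i : Option (IneqIdx m) => i.elim lamVar (gPoly C D)) (ePoly A B C D) hI d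
  refine ⟨M + 1, fun N hN p hpd hp ε hε => ?_⟩
  obtain ⟨s, t, r, hs, ht, hr, heq⟩ := hM p hpd
    (fun v he hg => hp v ⟨he, hg none, fun g => hg (some g)⟩) ε hε
  refine ⟨s, t none, fun g => t (some g), r, hs.mono (by omega), (ht none).mono (by omega),
    fun g => (ht _).mono (by omega), fun e => (hr e).trans (by omega), ?_⟩
  rw [map_neg, sub_neg_eq_add, heq, Fintype.sum_option, Option.elim_none]
  simp only [Option.elim_some, add_assoc]

theorem SosFeasible.of_sub_C {f : MvPolynomial (Var n m) ℝ} {ρ ε : ℝ}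
    (h : SosFeasible A B C D (f - MvPolynomial.C ρ) N (-ε)) : SosFeasible A B C D f N (ρ - ε) := by
  obtain ⟨s₀, sl, sg, p, h1, h2, h3, h4, h5⟩ := h
  refine ⟨s₀, sl, sg, p, h1, h2, h3, h4, ?_⟩
  rw [← h5, map_sub, map_neg]
  ring

/-- On polynomials of degree at most `d`, the functionals feasible for the moment relaxation of
large order are nonnegative wherever the polynomial is nonnegative on the feasible set. -/
theorem exists_forall_rieszHom_nonneg (hI : IsZeroDimensional (eqIdeal A B C D)) (d : ℕ) :
    ∃ N₀ : ℕ, ∀ N, N₀ ≤ N → ∀ y : MomentVec (Var n m) N, MomFeasible A B C D N y →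
      ∀ p : MvPolynomial (Var n m) ℝ, p.totalDegree ≤ d →
      (∀ v ∈ feasibleSet A B C D, 0 ≤ eval v p) → 0 ≤ rieszHom y p := by
  obtain ⟨N₀, hN₀⟩ := exists_forall_sosFeasible hI d
  refine ⟨N₀, fun N hN y hy p hpd hp => le_of_forall_pos_le_add fun ε hε => ?_⟩
  linarith [le_rieszHom_of_sosFeasible hy (hN₀ N hN p hpd hp ε hε)]

theorem finite_feasibleSet (hI : IsZeroDimensional (eqIdeal A B C D)) :
    (feasibleSet A B C D).Finite := by
  refine Set.Finite.of_finite_image (f := fun v i => (v i : ℂ)) (hI.subset ?_) ?_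
  · rintro _ ⟨v, hv, rfl⟩
    rw [eqIdeal, zeroLocus_span]
    rintro _ ⟨e, rfl⟩
    rw [aeval_ofReal, hv.1 e, Complex.ofReal_zero]
  · exact fun v _ w _ h => funext fun i => Complex.ofReal_injective (congrFun h i)

/-- Truncated to degree `d`, a feasible point of a moment relaxation of large order consists of the
moments of a measure on the finite feasible set; the mass of `v` is the value at the square of an
interpolation polynomial `h v`. -/
theorem exists_forall_rieszHom_eq_sum (hI : IsZeroDimensional (eqIdeal A B C D))
    (K : Finset (Var n m → ℝ)) (hK : ∀ v, v ∈ K ↔ v ∈ feasibleSet A B C D)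
    (h : (Var n m → ℝ) → MvPolynomial (Var n m) ℝ) (hone : ∀ v, eval v (h v) = 1)
    (hzero : ∀ v, ∀ u ∈ K, u ≠ v → eval u (h v) = 0) (d : ℕ)
    (hdeg : ∀ v, 2 * (h v).totalDegree ≤ d) :
    ∃ N₀ : ℕ, ∀ N, N₀ ≤ N → ∀ y : MomentVec (Var n m) N, MomFeasible A B C D N y →
      ∀ p : MvPolynomial (Var n m) ℝ, p.totalDegree ≤ d →
        rieszHom y p = ∑ v ∈ K, rieszHom y (h v ^ 2) * eval v p := by
  obtain ⟨N₀, hN₀⟩ := exists_forall_rieszHom_nonneg hI d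
  refine ⟨N₀, fun N hN y hy p hp => ?_⟩
  set q := p - ∑ v ∈ K, MvPolynomial.C (eval v p) * h v ^ 2 with hq
  have hqdeg : q.totalDegree ≤ d := by
    refine totalDegree_sub_le_of_le hp (totalDegree_finsetSum_le fun v _ => ?_)
    refine (totalDegree_mul _ _).trans ?_
    rw [totalDegree_C, zero_add]
    exact (totalDegree_pow _ _).trans (hdeg v)
  have hqzero : ∀ v ∈ feasibleSet A B C D, eval v q = 0 := by
    intro v hv
    rw [hq, map_sub, map_sum, Finset.sum_eq_single v]
    · simp [hone]
    · intro u _ huv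
      simp [hzero u v ((hK v).2 hv) huv.symm]
    · exact fun hn => absurd ((hK v).2 hv) hn
  have h1 := hN₀ N hN y hy q hqdeg fun v hv => (hqzero v hv).ge
  have h2 := hN₀ N hN y hy (-q) (by rwa [totalDegree_neg]) fun v hv => by
    rw [map_neg, hqzero v hv, neg_zero]
  rw [map_neg] at h2
  have h3 : rieszHom y q = 0 := by linarith
  rw [hq, map_sub, sub_eq_zero] at h3
  rw [h3, map_sum]
  refine Finset.sum_congr rfl fun v _ => ?_
  rw [C_mul', map_smul, smul_eq_mul, mul_comm]

end Duality

/-! ### Convergence of the values and extraction of the minimizers -/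

section Convergence

variable {n m : ℕ} {A : Matrix (Fin n) (Fin n) ℝ} {B : Matrix (Fin n) (Fin m) ℝ}
  {C : Matrix (Fin m) (Fin n) ℝ} {D : Matrix (Fin m) (Fin m) ℝ} {N : ℕ}

theorem fSos_le_fMom (f : MvPolynomial (Var n m) ℝ) (N : ℕ) :
    fSos A B C D f N ≤ fMom A B C D f N :=
  iSup₂_le fun _ hρ => le_iInf₂ fun y hy => EReal.coe_le_coe_iff.2 <| by
    rw [riesz_eq_rieszHom]
    exact le_rieszHom_of_sosFeasible hy hρ

theorem fMom_le_fMin {f : MvPolynomial (Var n m) ℝ} (hN : 1 ≤ N) (hf : f.totalDegree ≤ 2 * N) :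
    fMom A B C D f N ≤ fMin A B C D f :=
  le_iInf₂ fun v hv => iInf₂_le_of_le (diracMoments N v) (momFeasible_diracMoments hN hv) <| by
    rw [riesz_eq_rieszHom, rieszHom_diracMoments v hf]

theorem exists_forall_fMin_le_fSos (hI : IsZeroDimensional (eqIdeal A B C D))
    (f : MvPolynomial (Var n m) ℝ) :
    ∃ N₀ : ℕ, ∀ N, N₀ ≤ N → fMin A B C D f ≤ fSos A B C D f N := by
  obtain ⟨N₀, hN₀⟩ := exists_forall_sosFeasible hI f.totalDegree
  refine ⟨N₀, fun N hN => EReal.ge_of_forall_gt_iff_ge.1 fun ρ hρ => ?_⟩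
  obtain ⟨ρ', hρρ', hρ'⟩ := EReal.lt_iff_exists_real_btwn.1 hρ
  have hlt : ρ < ρ' := EReal.coe_lt_coe_iff.1 hρρ'
  have hfeas := hN₀ N hN (f - MvPolynomial.C ρ') (totalDegree_sub_C_le _ _) (fun v hv => by
    have h : (ρ' : EReal) ≤ (eval v f : ℝ) := hρ'.le.trans (iInf₂_le v hv)
    rw [map_sub, eval_C, sub_nonneg]
    exact EReal.coe_le_coe_iff.1 h) (ρ' - ρ) (sub_pos.2 hlt)
  have := hfeas.of_sub_C
  rw [sub_sub_cancel] at this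
  exact le_iSup₂_of_le ρ this le_rfl

/-- The kernel of the moment matrix of a maximal rank optimal solution is contained in the one of
every optimal solution: the midpoint of the two is optimal, and its kernel is the intersection. -/
theorem IsMaxRankOptimal.mulVec_eq_zero {f : MvPolynomial (Var n m) ℝ}
    {y y' : MomentVec (Var n m) N} (hy : IsMaxRankOptimal A B C D f N y)
    (hy' : IsMomOptimal A B C D f N y') {c : MIdx (Var n m) N → ℝ}
    (hc : (hankel N y).mulVec c = 0) : (hankel N y').mulVec c = 0 := by
  set z := (2⁻¹ : ℝ) • (y + y') with hz
  have hzfeas : MomFeasible A B C D N z := hy.1.1.average hy'.1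
  have hzopt : IsMomOptimal A B C D f N z := ⟨hzfeas, fun w hw => by
    have h1 := hy.1.2 w hw
    have h2 := hy'.2 w hw
    rw [riesz_eq_rieszHom] at h1 h2 ⊢
    rw [hz, rieszHom_average]
    linarith⟩
  have hker : ∀ b, (hankel N z).mulVec b = 0 →
      (hankel N y).mulVec b = 0 ∧ (hankel N y').mulVec b = 0 := by
    intro b hb
    rw [hankel_mulVec_eq_zero_iff_of_posSemidef hzfeas.hankel_psd, hz, rieszHom_average] at hb
    have hb1 := (momFeasible_iff.1 hy.1.1).2.1 _ (totalDegree_polyOfVec_le b)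
    have hb2 := (momFeasible_iff.1 hy'.1).2.1 _ (totalDegree_polyOfVec_le b)
    rw [hankel_mulVec_eq_zero_iff_of_posSemidef hy.1.1.hankel_psd,
      hankel_mulVec_eq_zero_iff_of_posSemidef hy'.1.hankel_psd]
    constructor <;> linarith
  have hle : LinearMap.ker (hankel N z).mulVecLin ≤ LinearMap.ker (hankel N y).mulVecLin :=
    fun b hb => (hker b hb).1
  have hrank := hy.2 z hzopt
  have h1 := (hankel N z).mulVecLin.finrank_range_add_finrank_ker
  have h2 := (hankel N y).mulVecLin.finrank_range_add_finrank_ker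
  rw [Matrix.rank, Matrix.rank] at hrank
  have heq := Submodule.eq_of_le_of_finrank_le hle (by omega)
  have hcz : c ∈ LinearMap.ker (hankel N z).mulVecLin := by
    rw [heq]
    exact hc
  exact (hker c hcz).2

/-- If the kernel of `H_k (y)` consists of the polynomials vanishing on a finite set `S` that admits
interpolation in degree `k`, then the rank of `H_k (y)` is the number of points of `S`. -/
theorem rank_hankel_eq_card {σ : Type*} [Finite σ] {k : ℕ} (y : MomentVec σ N)
    (S : Finset (σ → ℝ)) (h : (σ → ℝ) → MvPolynomial σ ℝ) (hone : ∀ v, eval v (h v) = 1)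
    (hzero : ∀ v, ∀ u ∈ S, u ≠ v → eval u (h v) = 0) (hdeg : ∀ v, (h v).totalDegree ≤ k)
    (hker : ∀ c : MIdx σ k → ℝ, (hankel k y).mulVec c = 0 ↔ ∀ v ∈ S, eval v (polyOfVec c) = 0) :
    (hankel k y).rank = S.card := by
  classical
  let ev : (MIdx σ k → ℝ) →ₗ[ℝ] (S → ℝ) :=
    { toFun := fun c v => eval v.1 (polyOfVec c)
      map_add' := fun b c => by
        ext v
        simp [polyOfVec, Finset.sum_add_distrib]
      map_smul' := fun a c => by
        ext v
        simp [polyOfVec, Finset.mul_sum, eval_monomial, mul_assoc] }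
  have hsurj : LinearMap.range ev = ⊤ := by
    rw [LinearMap.range_eq_top]
    intro w
    obtain ⟨c, hc⟩ := exists_polyOfVec_eq (k := k)
      (p := ∑ v : S, MvPolynomial.C (w v) * h v.1) (totalDegree_finsetSum_le fun v _ => by
        refine (totalDegree_mul _ _).trans ?_
        rw [totalDegree_C, zero_add]
        exact hdeg v)
    refine ⟨c, funext fun v => ?_⟩
    change eval v.1 (polyOfVec c) = w v
    rw [hc, map_sum, Finset.sum_eq_single v]
    · simp [hone]
    · intro u _ huv
      simp [hzero u.1 v.1 v.2 fun he => huv (Subtype.ext he.symm)]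
    · simp
  have hkereq : LinearMap.ker (hankel k y).mulVecLin = LinearMap.ker ev := by
    ext c
    rw [LinearMap.mem_ker, Matrix.mulVecLin_apply, hker, LinearMap.mem_ker, funext_iff]
    simp [ev]
  have h1 := (hankel k y).mulVecLin.finrank_range_add_finrank_ker
  have h2 := ev.finrank_range_add_finrank_ker
  rw [hsurj, finrank_top, Module.finrank_fintype_fun_eq_card, Fintype.card_coe] at h2
  rw [hkereq] at h1
  rw [Matrix.rank]
  omega

/-- If the kernel of `H_k (y)` consists of the polynomials vanishing on a finite set `S` with at
most `k` points, then the common complex zeros of the kernel are the points of `S`. -/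
theorem kernelVariety_eq_image {σ : Type*} [Finite σ] {k : ℕ} (y : MomentVec σ N)
    (S : Finset (σ → ℝ)) (hS : S.card ≤ k)
    (hker : ∀ c : MIdx σ k → ℝ, (hankel k y).mulVec c = 0 ↔ ∀ v ∈ S, eval v (polyOfVec c) = 0) :
    kernelVariety k y = (fun (v : σ → ℝ) (i : σ) => (v i : ℂ)) '' (S : Set (σ → ℝ)) := by
  ext v
  constructor
  · intro hv
    by_contra hne
    obtain ⟨p, hdeg, hp, hpv⟩ := exists_totalDegree_le_card_vanishing S v
      fun u hu he => hne ⟨u, hu, he⟩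
    obtain ⟨c, rfl⟩ := exists_polyOfVec_eq (hdeg.trans hS)
    exact hpv (hv c ((hker c).2 hp))
  · rintro ⟨u, hu, rfl⟩ c hc
    rw [aeval_ofReal, (hker c).1 hc u hu, Complex.ofReal_zero]

/-- Suppose that `y` acts on polynomials of degree at most `d` as the measure on `K` with masses
`L_y (h v ^ 2)`.  If `y` is optimal of maximal rank, the support of this measure is exactly the set
of minimizers, so that the kernel of a moment matrix `H_k (y)` with `2 * k ≤ d` consists of the
polynomials vanishing at the minimizers. -/
theorem IsMaxRankOptimal.hankel_mulVec_eq_zero_iff {f : MvPolynomial (Var n m) ℝ}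
    {y : MomentVec (Var n m) N} (hy : IsMaxRankOptimal A B C D f N y)
    (hN : 1 ≤ N) (K : Finset (Var n m → ℝ)) (hK : ∀ v, v ∈ K ↔ v ∈ feasibleSet A B C D)
    (h : (Var n m → ℝ) → MvPolynomial (Var n m) ℝ) (hone : ∀ v, eval v (h v) = 1)
    (hdegN : ∀ v, (h v).totalDegree ≤ N) {d k : ℕ} (hf : f.totalDegree ≤ d) (hk : 2 * k ≤ d)
    (hfN : f.totalDegree ≤ 2 * N)
    (hsum : ∀ p : MvPolynomial (Var n m) ℝ, p.totalDegree ≤ d →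
        rieszHom y p = ∑ v ∈ K, rieszHom y (h v ^ 2) * eval v p)
    (c : MIdx (Var n m) k → ℝ) :
    (hankel k y).mulVec c = 0 ↔ ∀ v ∈ minimizers A B C D f, eval v (polyOfVec c) = 0 := by
  have hfeas := momFeasible_iff.1 hy.1.1
  have hnonneg : ∀ v, 0 ≤ rieszHom y (h v ^ 2) := fun v => hfeas.2.1 _ (hdegN v)
  have hmass : ∑ v ∈ K, rieszHom y (h v ^ 2) = 1 := by
    rw [← hfeas.1, hsum 1 (by simp)]
    simp
  have hle : ∀ u ∈ feasibleSet A B C D, rieszHom y f ≤ eval u f := fun u hu => by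
    have := hy.1.2 _ (momFeasible_diracMoments hN hu)
    rwa [riesz_eq_rieszHom, riesz_eq_rieszHom, rieszHom_diracMoments u hfN] at this
  -- The average of `f` over the measure is at most its value at each point.
  have hsupp : ∀ v ∈ K, rieszHom y (h v ^ 2) ≠ 0 → v ∈ minimizers A B C D f := by
    intro v hv hne
    have hzero : ∑ u ∈ K, rieszHom y (h u ^ 2) * (eval u f - rieszHom y f) = 0 := by
      simp only [mul_sub, Finset.sum_sub_distrib, ← Finset.sum_mul]
      rw [hmass, ← hsum f hf, one_mul, sub_self]
    have hterm := (Finset.sum_eq_zero_iff_of_nonneg fun u hu =>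
      mul_nonneg (hnonneg u) (sub_nonneg.2 (hle u ((hK u).1 hu)))).1 hzero v hv
    have heq : eval v f = rieszHom y f :=
      sub_eq_zero.1 ((mul_eq_zero.1 hterm).resolve_left hne)
    exact ⟨(hK v).1 hv, fun u hu => heq ▸ hle u hu⟩
  have hpos : ∀ v ∈ minimizers A B C D f, 0 < rieszHom y (h v ^ 2) := by
    intro v hv
    -- Without mass at `v`, the polynomial `h v` would be in the kernel of `H_N (y)`, hence in that
    -- of the moment matrix of the Dirac measure at `v`, although it does not vanish at `v`.
    refine lt_of_le_of_ne (hnonneg v) fun h0 => ?_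
    have hopt : IsMomOptimal A B C D f N (diracMoments N v) := by
      refine ⟨momFeasible_diracMoments hN hv.1, fun y' hy' => ?_⟩
      refine le_trans ?_ (hy.1.2 y' hy')
      rw [riesz_eq_rieszHom, riesz_eq_rieszHom, rieszHom_diracMoments v hfN, hsum f hf,
        ← one_mul (eval v f), ← hmass, Finset.sum_mul]
      exact Finset.sum_le_sum fun u hu =>
        mul_le_mul_of_nonneg_left (hv.2 u ((hK u).1 hu)) (hnonneg u)
    obtain ⟨b, hb⟩ := exists_polyOfVec_eq (hdegN v)
    have hby : (hankel N y).mulVec b = 0 := by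
      rw [hankel_mulVec_eq_zero_iff_of_posSemidef hy.1.1.hankel_psd, hb, ← h0]
    have hbv := hy.mulVec_eq_zero hopt hby
    rw [hankel_mulVec_eq_zero_iff_of_posSemidef hopt.1.hankel_psd, hb, rieszHom_diracMoments v
      ((totalDegree_pow _ _).trans (Nat.mul_le_mul_left _ (hdegN v))), map_pow, hone] at hbv
    norm_num at hbv
  rw [ReluPOP.hankel_mulVec_eq_zero_iff]
  have hdeg : ∀ q : MvPolynomial (Var n m) ℝ, q.totalDegree ≤ k →
      (q * polyOfVec c).totalDegree ≤ d := fun q hq =>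
    (totalDegree_mul _ _).trans (by have := totalDegree_polyOfVec_le c; omega)
  constructor
  · intro hc v hv
    have h0 := hc _ (totalDegree_polyOfVec_le c)
    rw [hsum _ (hdeg _ (totalDegree_polyOfVec_le c))] at h0
    have hterm := (Finset.sum_eq_zero_iff_of_nonneg fun u _ => mul_nonneg (hnonneg u) (by
      rw [map_mul]
      exact mul_self_nonneg _)).1 h0 v ((hK v).2 hv.1)
    rw [map_mul] at hterm
    exact mul_self_eq_zero.1 ((mul_eq_zero.1 hterm).resolve_left (hpos v hv).ne')
  · intro hc q hq
    rw [hsum _ (hdeg q hq)]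
    refine Finset.sum_eq_zero fun v hv => ?_
    by_cases h0 : rieszHom y (h v ^ 2) = 0
    · rw [h0, zero_mul]
    · rw [map_mul, hc v (hsupp v hv h0), mul_zero, mul_zero]

end Convergence

end ReluPOP

end

theorem mainTheorem8 {n m : ℕ} (A : Matrix (Fin n) (Fin n) ℝ) (B : Matrix (Fin n) (Fin m) ℝ)
    (C : Matrix (Fin m) (Fin n) ℝ) (D : Matrix (Fin m) (Fin m) ℝ)
    (f : MvPolynomial (ReluPOP.Var n m) ℝ)
    (hI : ReluPOP.IsZeroDimensional (ReluPOP.eqIdeal A B C D)) :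
    (∃ N₀ : ℕ, ∀ N : ℕ, N₀ ≤ N →
      ReluPOP.fMom A B C D f N = ReluPOP.fMin A B C D f ∧
      ReluPOP.fSos A B C D f N = ReluPOP.fMin A B C D f) ∧
    (∃ N₀ : ℕ, ∀ N : ℕ, N₀ ≤ N →
      ∃ s : ℕ, 1 ≤ s ∧ s ≤ N ∧
        ∀ y : ReluPOP.MomentVec (ReluPOP.Var n m) N,
          ReluPOP.IsMaxRankOptimal A B C D f N y →
          (ReluPOP.hankel s y).rank = (ReluPOP.hankel (s - 1) y).rank ∧
          (fun (v : ReluPOP.Var n m → ℝ) (i : ReluPOP.Var n m) => (v i : ℂ)) ''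
              ReluPOP.minimizers A B C D f =
            ReluPOP.kernelVariety s y) := by
  classical
  open ReluPOP in
  constructor
  · obtain ⟨N₀, hN₀⟩ := exists_forall_fMin_le_fSos hI f
    refine ⟨N₀ + f.totalDegree + 1, fun N hN => ?_⟩
    have h1 := hN₀ N (by omega)
    have h2 := fSos_le_fMom (A := A) (B := B) (C := C) (D := D) f N
    have h3 := fMom_le_fMin (A := A) (B := B) (C := C) (D := D) (f := f) (N := N)
      (by omega) (by omega)
    exact ⟨h3.antisymm (h1.trans h2), (h2.trans h3).antisymm h1⟩
  · have hfin := finite_feasibleSet hI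
    set K := hfin.toFinset
    have hK : ∀ v, v ∈ K ↔ v ∈ feasibleSet A B C D := fun v => hfin.mem_toFinset
    choose h hdeg hone hzero using exists_lagrange K
    obtain ⟨N₀, hN₀⟩ := exists_forall_rieszHom_eq_sum hI K hK h hone hzero
      (2 * (K.card + 1) + f.totalDegree) fun v => by have := hdeg v; omega
    -- Interpolation on `K` already works in degree `|K|`, so the rank is stable from there on.
    refine ⟨N₀ + K.card + 1 + f.totalDegree, fun N hN =>
      ⟨K.card + 1, by omega, by omega, fun y hy => ?_⟩⟩
    have hmin : (minimizers A B C D f).Finite := hfin.subset fun v hv => hv.1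
    have hminK : hmin.toFinset ⊆ K := fun v hv => (hK v).2 (hmin.mem_toFinset.1 hv).1
    have hker : ∀ k, k ≤ K.card + 1 → ∀ c : MIdx (Var n m) k → ℝ, (hankel k y).mulVec c = 0 ↔
        ∀ v ∈ hmin.toFinset, eval v (polyOfVec c) = 0 := fun k hk c => by
      simp only [Set.Finite.mem_toFinset]
      exact hy.hankel_mulVec_eq_zero_iff (by omega) K hK h hone
        (fun v => (hdeg v).trans (by omega)) (by omega) (by omega) (by omega)
        (hN₀ N (by omega) y hy.1.1) c
    have hrank : ∀ k, K.card ≤ k → k ≤ K.card + 1 → (hankel k y).rank = hmin.toFinset.card :=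
      fun k hk hk' => rank_hankel_eq_card y hmin.toFinset h hone
        (fun v u hu => hzero v u (hminK hu)) (fun v => (hdeg v).trans hk) (hker k hk')
    refine ⟨(hrank _ (by omega) le_rfl).trans (hrank _ le_rfl (by omega)).symm, ?_⟩
    rw [kernelVariety_eq_image y hmin.toFinset ((Finset.card_le_card hminK).trans (by omega))
      (hker _ le_rfl), hmin.coe_toFinset]
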